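/- Let $p$ be a prime number and let $(L,\delta)/(K,\delta)$ be an extension of (ordinary) differential fields of characteristic $p$. Write $K^p=\{x^p : x\in K\}$ and $L^p=\{x^p : x\in L\}$ for the subfields of $p$-th powers, and $C_K=\{x\in K:\delta(x)=0\}$ for the field of constants of $K$, so that $K^p\subseteq C_K\subseteq K$. The field extension $L/K$ (not assumed algebraic) is called separable if $K$ and $L^p$ are linearly disjoint over $K^p$. For a differential field $(F,\delta)$ of characteristic $p$ and $A\subseteq F$, the $p$-monomials of $A$ are the products $\prod_{a\in A}a^{e(a)}$, where $e:A\to\{0,\dots,p-1\}$ has finite support. The set $A$ is differentially $p$-independent in $(F,\delta)$ if $A\subseteq C_F$ and the family of its $p$-monomials, indexed by the functions $e$, is linearly independent over $F^p$. It is differentially $p$-spanning in $(F,\delta)$ if $A\subseteq C_F$ and its $p$-monomials span $C_F$ over $F^p$. It is a differential $p$-basis of $(F,\delta)$ if it is both. Then the following are equivalent: 1. $L/K$ is separable; 2. $C_K$ and $L^p$ are linearly disjoint over $K^p$; 3. every differentially $p$-independent subset of $(K,\delta)$ is also differentially $p$-independent in $(L,\delta)$; 4. there exists a differential $p$-basis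 of $(K,\delta)$ that is differentially $p$-independent in $(L,\delta)$. -/

import Mathlib

open scoped Differential

noncomputable section

/-- The subfield `K ^ p` of `p`-th powers of a field `K` of characteristic `p`. -/
def pthPowers (p : ℕ) [Fact p.Prime] (K : Type*) [Field K] [CharP K p] : Subfield K :=
  (frobenius K p).fieldRange

theorem mem_pthPowers {p : ℕ} [Fact p.Prime] {K : Type*} [Field K] [CharP K p] {x : K} :
    x ∈ pthPowers p K ↔ ∃ y : K, y ^ p = x := by
  simp [pthPowers, RingHom.mem_fieldRange, frobenius_def]

/-- The subfield `C_K` of constants of a differential field `K`. -/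
def constantField (K : Type*) [Field K] [Differential K] : Subfield K where
  carrier := {x | x′ = 0}
  mul_mem' {a b} ha hb := by
    simp only [Set.mem_ofPred_eq] at *
    simp [ha, hb]
  one_mem' := by simp
  add_mem' {a b} ha hb := by
    simp only [Set.mem_ofPred_eq] at *
    simp [ha, hb]
  zero_mem' := by simp
  neg_mem' {a} ha := by
    simp only [Set.mem_ofPred_eq] at *
    simp [ha]
  inv_mem' a ha := by
    simp only [Set.mem_ofPred_eq] at *
    simp [Derivation.leibniz_inv, ha]

theorem mem_constantField {K : Type*} [Field K] [Differential K] {x : K} :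
    x ∈ constantField K ↔ x′ = 0 := Iff.rfl

theorem pthPowers_le_constantField (p : ℕ) [Fact p.Prime] (K : Type*) [Field K] [CharP K p]
    [Differential K] : pthPowers p K ≤ constantField K := by
  intro x hx
  obtain ⟨y, rfl⟩ := mem_pthPowers.1 hx
  rw [mem_constantField, Derivation.leibniz_pow]
  simp [← Nat.cast_smul_eq_nsmul K]

section Extension

variable (p : ℕ) [Fact p.Prime] (K L : Type*) [Field K] [CharP K p] [Field L] [CharP L p]
  [Algebra K L]

/-- `K`, seen inside `L`, as an intermediate field of `L / K ^ p`. -/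
def baseIn : IntermediateField (pthPowers p K) L :=
  (IsScalarTower.toAlgHom (pthPowers p K) K L).fieldRange

/-- `L ^ p` as an intermediate field of `L / K ^ p`. -/
def pthPowersIn : IntermediateField (pthPowers p K) L :=
  (pthPowers p L).toIntermediateField fun x => by
    obtain ⟨y, hy⟩ := mem_pthPowers.1 x.2
    refine mem_pthPowers.2 ⟨algebraMap K L y, ?_⟩
    rw [← map_pow, hy]
    rfl

/-- `C_K`, seen inside `L`, as an intermediate field of `L / K ^ p`. -/
def constantsIn [Differential K] : IntermediateField (pthPowers p K) L :=
  IntermediateField.map (IsScalarTower.toAlgHom (pthPowers p K) K L)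
    ((constantField K).toIntermediateField fun x => pthPowers_le_constantField p K x.2)

/-- A field extension `L / K` of characteristic `p`, not necessarily algebraic, is separable if
`K` and `L ^ p` are linearly disjoint over `K ^ p`. -/
def IsSeparableExt : Prop :=
  (baseIn p K L).LinearDisjoint (pthPowersIn p K L)

end Extension

section PIndependence

variable (p : ℕ) [Fact p.Prime] {K : Type*} [Field K] [CharP K p]

/-- The family of `p`-monomials of `A`, indexed by the finitely supported exponent functions on
`A` with values in `{0, …, p - 1}`. -/
def pMonomial (A : Set K) (e : {e : A →₀ ℕ // ∀ a, e a < p}) : K :=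
  e.1.prod fun a n => (a : K) ^ n

variable [Differential K]

/-- `A` consists of constants, and its `p`-monomials are linearly independent over `K ^ p`. -/
def DiffPIndependent (A : Set K) : Prop :=
  A ⊆ (constantField K : Set K) ∧ LinearIndependent (pthPowers p K) (pMonomial p A)

/-- `A` consists of constants, and its `p`-monomials span `C_K` over `K ^ p`. -/
def DiffPSpanning (A : Set K) : Prop :=
  A ⊆ (constantField K : Set K) ∧
    (Submodule.span (pthPowers p K) (Set.range (pMonomial p A)) : Set K) =
      (constantField K : Set K)

def IsDiffPBasis (A : Set K) : Prop :=
  DiffPIndependent p A ∧ DiffPSpanning p A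

end PIndependence

end

/-! The substance is 2 ⇒ 1. A basis of `L ^ p` over `K ^ p` consists of constants of `L`; by 2 it
stays independent over `C_K`. Constants of `L` independent over `C_K` are independent over `K`
(`LinearIndependent.of_constantField`), by differentiating a normalised relation, so the basis
witnesses separability.

The link with monomials is that those of a differential `p`-basis form a basis of `C_K` over `K ^
p`, and linear disjointness can be tested on one basis of one side. Existence of a differential
`p`-basis (`exists_isDiffPBasis`) is a Zorn argument: a constant outside `K ^ p (A)` has degree `p`
over that field, so it can be added to `A`. -/

set_option linter.unusedSectionVars false

/-! ### Monomials with exponents on all of `K`, so that varying `A` only varies the index set of one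
family -/

section Monomials

variable {K : Type*} [Field K]

/-- The monomial `∏ a, a ^ e a` in elements of a field. -/
def fieldMonomial (e : K →₀ ℕ) : K :=
  e.prod fun a n => a ^ n

/-- The exponent functions with values in `{0, …, p - 1}` and support in `A`. -/
def pExponents (p : ℕ) (A : Set K) : Set (K →₀ ℕ) :=
  {e | (∀ a, e a < p) ∧ (e.support : Set K) ⊆ A}

theorem fieldMonomial_eq_erase_mul (e : K →₀ ℕ) (a : K) :
    fieldMonomial e = fieldMonomial (e.erase a) * a ^ e a := by
  rw [mul_comm]
  exact (Finsupp.mul_prod_erase' e a _ fun _ => pow_zero _).symm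

theorem erase_mem_pExponents {p : ℕ} {A B : Set K} {e : K →₀ ℕ} {a : K}
    (he : e ∈ pExponents p A) (h : A ⊆ insert a B) : e.erase a ∈ pExponents p B := by
  refine ⟨fun b => ?_, fun b hb => ?_⟩
  · by_cases hba : b = a
    · subst hba
      simpa using (Nat.zero_le _).trans_lt (he.1 b)
    · simpa [Finsupp.erase_ne hba] using he.1 b
  · rw [Finset.mem_coe, Finsupp.mem_support_iff] at hb
    have hba : b ≠ a := fun hba => hb (by rw [hba, Finsupp.erase_same])
    rw [Finsupp.erase_ne hba] at hb
    exact (h (he.2 (Finsupp.mem_support_iff.2 hb))).resolve_left hba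

theorem pExponents_sUnion {p : ℕ} {c : Set (Set K)} (hc : DirectedOn (· ⊆ ·) c)
    (hne : c.Nonempty) : pExponents p (⋃₀ c) = ⋃ s ∈ c, pExponents p s := by
  ext e
  simp only [Set.mem_iUnion, exists_prop]
  constructor
  · rintro ⟨h1, h2⟩
    obtain ⟨s, hs, h⟩ := DirectedOn.exists_mem_subset_of_finset_subset_biUnion hne
      (f := fun s : Set K => s) hc
      (s := e.support) (by rwa [← Set.sUnion_eq_biUnion])
    exact ⟨s, hs, h1, h⟩
  · rintro ⟨s, hs, h1, h2⟩
    exact ⟨h1, h2.trans (Set.subset_sUnion_of_mem hs)⟩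

/-- An exponent function on `A`, extended by zero. -/
noncomputable def extendExponent (A : Set K) (e : A →₀ ℕ) : K →₀ ℕ :=
  e.embDomain (Function.Embedding.subtype (· ∈ A))

theorem extendExponent_mem {p : ℕ} [Fact p.Prime] {A : Set K}
    (e : {e : A →₀ ℕ // ∀ a, e a < p}) : extendExponent A e.1 ∈ pExponents p A := by
  refine ⟨fun a => ?_, fun a ha => ?_⟩
  · by_cases ha : a ∈ A
    · exact (Finsupp.embDomain_apply_self (Function.Embedding.subtype _) e.1 ⟨a, ha⟩).trans_lt
        (e.2 _)
    · rw [extendExponent, Finsupp.embDomain_of_notMem_range _ _ _ (by simpa using ha)]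
      exact (Fact.out : p.Prime).pos
  · rw [extendExponent, Finsupp.support_embDomain] at ha
    obtain ⟨b, -, rfl⟩ := Finset.mem_map.1 ha
    exact b.2

theorem fieldMonomial_extendExponent {p : ℕ} [Fact p.Prime] [CharP K p] {A : Set K}
    (e : {e : A →₀ ℕ // ∀ a, e a < p}) :
    fieldMonomial (extendExponent A e.1) = pMonomial p A e :=
  Finsupp.prod_embDomain

theorem range_pMonomial (p : ℕ) [Fact p.Prime] [CharP K p] (A : Set K) :
    Set.range (pMonomial p A) = fieldMonomial '' pExponents p A := by
  ext x
  constructor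
  · rintro ⟨e, rfl⟩
    exact ⟨_, extendExponent_mem e, fieldMonomial_extendExponent e⟩
  · rintro ⟨e, he, rfl⟩
    exact ⟨⟨e.subtypeDomain (· ∈ A), fun a => he.1 a⟩,
      Finsupp.prod_subtypeDomain_index (h := fun a n => a ^ n) he.2⟩

theorem linearIndependent_pMonomial {p : ℕ} [Fact p.Prime] [CharP K p] {A : Set K}
    {F : Type*} [Field F] [Algebra F K] (h : LinearIndepOn F fieldMonomial (pExponents p A)) :
    LinearIndependent F (pMonomial p A) := by
  have := h.comp (fun e : {e : A →₀ ℕ // ∀ a, e a < p} => ⟨_, extendExponent_mem e⟩) (fun e f hef =>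
    Subtype.ext (Finsupp.embDomain_injective _ (congrArg Subtype.val hef)))
  convert this using 1
  ext e
  exact (fieldMonomial_extendExponent e).symm

end Monomials

/-! ### Span of the `p`-monomials and existence of a differential `p`-basis -/

section PClosure

variable {p : ℕ} [Fact p.Prime] {K : Type*} [Field K] [CharP K p]

theorem pow_mem_pthPowers (x : K) : x ^ p ∈ pthPowers p K :=
  mem_pthPowers.2 ⟨x, rfl⟩

theorem isIntegral_pthPowers (x : K) : IsIntegral (pthPowers p K) x :=
  .of_pow (Fact.out : p.Prime).pos
    (isIntegral_algebraMap (x := (⟨x ^ p, pow_mem_pthPowers x⟩ : pthPowers p K)))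

theorem mul_mem_span_fieldMonomial {A : Set K} {a x : K} (ha : a ∈ A)
    (hx : x ∈ Submodule.span (pthPowers p K) (fieldMonomial '' pExponents p A)) :
    a * x ∈ Submodule.span (pthPowers p K) (fieldMonomial '' pExponents p A) := by
  induction hx using Submodule.span_induction with
  | zero => simp
  | add x y _ _ hx hy => rw [mul_add]; exact add_mem hx hy
  | smul c x _ hx => rw [mul_smul_comm]; exact Submodule.smul_mem _ _ hx
  | mem x hx =>
    obtain ⟨e, he, rfl⟩ := hx
    have hA : A ⊆ insert a A := Set.subset_insert _ _
    -- Either the exponent of `a` can still be raised, or it reaches `p` and `a ^ p` becomes a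
    -- scalar.
    rcases (Nat.succ_le_of_lt (he.1 a)).lt_or_eq with h | h
    · refine Submodule.subset_span ⟨e.update a (e a + 1), ⟨fun b => ?_, fun b hb => ?_⟩, ?_⟩
      · classical
        rw [Finsupp.update_apply]
        split_ifs
        exacts [h, he.1 b]
      · by_cases hba : b = a
        · rwa [hba]
        · refine he.2 ?_
          classical
          simpa [Finsupp.update_apply, hba] using hb
      · rw [fieldMonomial_eq_erase_mul _ a, fieldMonomial_eq_erase_mul e a]
        have hupd : e.update a (e a + 1) a = e a + 1 := by
          classical
          rw [Finsupp.update_apply, if_pos rfl]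
        rw [Finsupp.erase_update_eq_erase, hupd]
        ring
    · have : a * fieldMonomial e =
          (⟨a ^ p, pow_mem_pthPowers a⟩ : pthPowers p K) • fieldMonomial (e.erase a) := by
        rw [fieldMonomial_eq_erase_mul e a, Subfield.smul_def, smul_eq_mul]
        have hpow : a ^ p = a * a ^ e a := by rw [← h, Nat.succ_eq_add_one, pow_succ']
        change _ = a ^ p * _
        rw [hpow]
        ring
      rw [this]
      exact Submodule.smul_mem _ _ (Submodule.subset_span ⟨_, erase_mem_pExponents he hA, rfl⟩)

theorem fieldMonomial_mem_adjoin {F : Type*} [Field F] [Algebra F K] {A : Set K} {e : K →₀ ℕ}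
    (he : e ∈ pExponents p A) :
    fieldMonomial e ∈ IntermediateField.adjoin F A :=
  prod_mem fun _ ha => pow_mem (IntermediateField.subset_adjoin _ _ (he.2 ha)) _

theorem one_mem_span_fieldMonomial (A : Set K) :
    (1 : K) ∈ Submodule.span (pthPowers p K) (fieldMonomial '' pExponents p A) :=
  Submodule.subset_span
    ⟨0, ⟨fun _ => (Fact.out : p.Prime).pos, by simp⟩, Finsupp.prod_zero_index⟩

theorem span_fieldMonomial (A : Set K) :
    Submodule.span (pthPowers p K) (fieldMonomial '' pExponents p A) =
      Subalgebra.toSubmodule (IntermediateField.adjoin (pthPowers p K) A).toSubalgebra := by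
  apply le_antisymm
  · rw [Submodule.span_le]
    rintro _ ⟨e, he, rfl⟩
    exact fieldMonomial_mem_adjoin he
  · rw [IntermediateField.adjoin_toSubalgebra_of_isAlgebraic
      fun x _ => (isIntegral_pthPowers x).isAlgebraic, Algebra.adjoin_eq_span, Submodule.span_le]
    intro x hx
    induction hx using Submonoid.closure_induction_left with
    | one => exact one_mem_span_fieldMonomial A
    | mul_left a ha x _ hx => exact mul_mem_span_fieldMonomial ha hx

/-- By injectivity of Frobenius, a `p`-th root in `E` of `c ^ p` would be `c` itself; hence `X ^ p -
c ^ p` is irreducible over `E` and `c` has degree `p`. -/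
theorem linearIndependent_pow_of_pow_mem {E : Type*} [Field E] [Algebra E K] {c : K}
    (hc : c ∉ (algebraMap E K).range) (hy : c ^ p ∈ (algebraMap E K).range) :
    LinearIndependent E fun i : Fin p => c ^ (i : ℕ) := by
  obtain ⟨d, hd⟩ := hy
  have hirr : Irreducible (Polynomial.X ^ p - Polynomial.C d) := by
    refine X_pow_sub_C_irreducible_of_prime Fact.out fun b hb => hc ⟨b, ?_⟩
    apply frobenius_inj K p
    simp only [frobenius_def, ← map_pow, hb, hd]
  have hmin : minpoly E c = Polynomial.X ^ p - Polynomial.C d :=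
    (minpoly.eq_of_irreducible_of_monic hirr (by simp [hd])
      (Polynomial.monic_X_pow_sub_C _ (Fact.out : p.Prime).ne_zero)).symm
  have hdeg : (minpoly E c).natDegree = p := by
    rw [hmin, Polynomial.natDegree_X_pow_sub_C]
  have := linearIndependent_pow (K := E) c
  rwa [hdeg] at this

/-- Tower argument through `K ^ p (A)`: each monomial splits as a `c`-free monomial times a power of
`c`, and products of the two independent families are independent. -/
theorem LinearIndepOn.fieldMonomial_insert {A : Set K} {c : K}
    (hA : LinearIndepOn (pthPowers p K) fieldMonomial (pExponents p A))
    (hc : c ∉ IntermediateField.adjoin (pthPowers p K) A) :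
    LinearIndepOn (pthPowers p K) fieldMonomial (pExponents p (insert c A)) := by
  set E := IntermediateField.adjoin (pthPowers p K) A
  have hpow : LinearIndependent E fun i : Fin p => c ^ (i : ℕ) :=
    linearIndependent_pow_of_pow_mem (fun ⟨b, hb⟩ => hc (hb ▸ b.2))
      ⟨algebraMap (pthPowers p K) E ⟨c ^ p, pow_mem_pthPowers c⟩, rfl⟩
  have hmon : LinearIndependent (pthPowers p K)
      fun e : pExponents p A => (⟨fieldMonomial e.1, fieldMonomial_mem_adjoin e.2⟩ : E) :=
    LinearIndependent.of_comp E.val.toLinearMap hA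
  have := (linearIndependent_smul hmon hpow).comp
    (fun e : pExponents p (insert c A) =>
      (⟨e.1.erase c, erase_mem_pExponents e.2 subset_rfl⟩, ⟨e.1 c, e.2.1 c⟩)) ?_
  · have heq : (fun e : pExponents p (insert c A) => fieldMonomial e.1) = _ :=
      funext fun e => fieldMonomial_eq_erase_mul e.1 c
    rw [LinearIndepOn, heq]
    exact this
  · intro e f hef
    simp only [Prod.mk.injEq, Subtype.mk.injEq, Fin.mk.injEq] at hef
    refine Subtype.ext (Finsupp.ext fun a => ?_)
    by_cases hac : a = c
    · rw [hac, hef.2]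
    · rw [← Finsupp.erase_ne (f := e.1) hac, hef.1, Finsupp.erase_ne hac]

theorem exists_isDiffPBasis (p : ℕ) [Fact p.Prime] (K : Type*) [Field K] [CharP K p]
    [Differential K] : ∃ A : Set K, IsDiffPBasis p A := by
  obtain ⟨A, hA⟩ := zorn_subset {A : Set K | A ⊆ (constantField K : Set K) ∧
      LinearIndepOn (pthPowers p K) fieldMonomial (pExponents p A)} fun c hc hchain => by
    rcases c.eq_empty_or_nonempty with rfl | hne
    · refine ⟨∅, ⟨Set.empty_subset _, ?_⟩, by simp⟩
      have : pExponents p (∅ : Set K) = {0} := by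
        ext e
        simp only [pExponents, Set.subset_empty_iff, Finset.coe_eq_empty,
          Finsupp.support_eq_empty, Set.mem_ofPred_eq, Set.mem_singleton_iff]
        refine ⟨And.right, ?_⟩
        rintro rfl
        exact ⟨fun _ => (Fact.out : p.Prime).pos, rfl⟩
      rw [this, linearIndepOn_singleton_iff]
      simp [fieldMonomial]
    · refine ⟨⋃₀ c, ⟨Set.sUnion_subset fun s hs => (hc hs).1, ?_⟩,
        fun s => Set.subset_sUnion_of_mem⟩
      rw [pExponents_sUnion hchain.directedOn hne]
      refine linearIndepOn_biUnion_of_directed ?_ fun s hs => (hc hs).2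
      intro s hs t ht
      obtain ⟨u, hu, hsu, htu⟩ := hchain.directedOn s hs t ht
      exact ⟨u, hu, fun e he => ⟨he.1, he.2.trans hsu⟩, fun e he => ⟨he.1, he.2.trans htu⟩⟩
  refine ⟨A, ⟨hA.prop.1, linearIndependent_pMonomial hA.prop.2⟩, hA.prop.1, ?_⟩
  rw [range_pMonomial, span_fieldMonomial]
  apply Set.Subset.antisymm
  · have : IntermediateField.adjoin (pthPowers p K) A ≤
        (constantField K).toIntermediateField fun x => pthPowers_le_constantField p K x.2 :=
      IntermediateField.adjoin_le_iff.2 hA.prop.1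
    exact this
  · intro c hc
    by_contra hcA
    -- A constant outside `K ^ p (A)` would enlarge the maximal `A`.
    have hmem : c ∈ A := hA.le_of_ge
      (y := insert c A) ⟨Set.insert_subset hc hA.prop.1, hA.prop.2.fieldMonomial_insert hcA⟩
      (Set.subset_insert _ _) (Set.mem_insert _ _)
    exact hcA (IntermediateField.subset_adjoin _ _ hmem)

end PClosure

/-! ### Independence over the constants of `K` lifts to `K` -/

section Constants

variable {K L : Type*} [Field K] [Field L] [Differential K] [Differential L] [Algebra K L]
  [DifferentialAlgebra K L]

/-- Constants of `L` that are linearly independent over the constants of `K` are linearly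
independent over `K`. -/
theorem LinearIndependent.of_constantField {ι : Type*} {w : ι → L} (hw : ∀ i, (w i)′ = 0)
    (h : LinearIndependent (constantField K) w) : LinearIndependent K w := by
  classical
  rw [linearIndependent_iff']
  intro s
  induction s using Finset.induction_on with
  | empty => simp
  | insert j s hj ih =>
    intro k hk
    have hkj : k j = 0 := by
      by_contra hkj
      -- With the coefficient at `j` normalised to 1, differentiation removes that term. The
      -- induction hypothesis then makes every ratio constant, giving a forbidden relation over
      -- `C_K`.
      have hm : ∑ i ∈ insert j s, (k i / k j) • w i = 0 := by
        have := congrArg (fun x => (k j)⁻¹ • x) hk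
        simpa [Finset.smul_sum, smul_smul, div_eq_inv_mul] using this
      have hd : ∑ i ∈ insert j s, (k i / k j)′ • w i = 0 := by
        have := congrArg (fun x : L => x′) hm
        simpa [-map_div₀, Algebra.smul_def, Derivation.leibniz, hw, deriv_algebraMap, map_sum,
          mul_comm] using this
      rw [Finset.sum_insert hj, div_self hkj, Derivation.map_one_eq_zero, zero_smul,
        zero_add] at hd
      have hconst (i) (hi : i ∈ insert j s) : (k i / k j)′ = 0 := by
        rcases Finset.mem_insert.1 hi with rfl | hi
        · rw [div_self hkj, Derivation.map_one_eq_zero]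
        · exact ih _ hd i hi
      have := linearIndependent_iff'.1 h (insert j s)
        (fun i => if hi : i ∈ insert j s then ⟨k i / k j, hconst i hi⟩ else 0) (by
          rw [← hm]
          refine Finset.sum_congr rfl fun i hi => ?_
          rw [dif_pos hi]
          rfl) j (Finset.mem_insert_self _ _)
      rw [dif_pos (Finset.mem_insert_self _ _)] at this
      exact div_ne_zero hkj hkj (congrArg Subtype.val this)
    rw [Finset.sum_insert hj, hkj, zero_smul, zero_add] at hk
    intro i hi
    rcases Finset.mem_insert.1 hi with rfl | hi
    exacts [hkj, ih _ hk i hi]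

end Constants

/-! ### Transfer of monomials and independence from `K` to `L` -/

section Extension

variable {p : ℕ} [Fact p.Prime] {K L : Type*} [Field K] [CharP K p] [Field L] [CharP L p]
  [Algebra K L]

theorem linearIndependent_pthPowersIn_iff {ι : Type*} {v : ι → L} :
    LinearIndependent (pthPowersIn p K L) v ↔ LinearIndependent (pthPowers p L) v :=
  Iff.rfl

theorem linearIndependent_baseIn {ι : Type*} {v : ι → L} (h : LinearIndependent K v) :
    LinearIndependent (baseIn p K L) v :=
  h.map_of_surjective_injective
    (fun x => (⟨algebraMap K L x, x, rfl⟩ : baseIn p K L)) (AddMonoidHom.id L)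
    (fun ⟨_, x, hx⟩ => ⟨x, Subtype.ext hx⟩) (by simp)
    (fun x y => by rw [Algebra.smul_def]; rfl)

variable [Differential K]

theorem constantsIn_le_baseIn : constantsIn p K L ≤ baseIn p K L := by
  rintro _ ⟨x, -, rfl⟩
  exact ⟨x, rfl⟩

theorem LinearIndependent.of_constantsIn {ι : Type*} {v : ι → L}
    (h : LinearIndependent (constantsIn p K L) v) : LinearIndependent (constantField K) v :=
  h.map_of_injective_injective
    (fun c : constantField K => (⟨algebraMap K L c, ⟨c, c.2, rfl⟩⟩ : constantsIn p K L))
    (AddMonoidHom.id L)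
    (fun c hc => Subtype.ext (by simpa using congrArg Subtype.val hc)) (by simp)
    (fun c x => by
      change algebraMap K L c * x = (c : K) • x
      rw [Algebra.smul_def])

theorem pMonomial_mem_constantField {A : Set K} (hA : A ⊆ (constantField K : Set K))
    (e : {e : A →₀ ℕ // ∀ a, e a < p}) : pMonomial p A e ∈ constantField K :=
  prod_mem fun a _ => pow_mem (hA a.2) _

theorem algebraMap_mem_constantField [Differential L] [DifferentialAlgebra K L] {x : K}
    (hx : x ∈ constantField K) : algebraMap K L x ∈ constantField L := by
  rw [mem_constantField, deriv_algebraMap, mem_constantField.1 hx, map_zero]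

/-- The `p`-monomials of a set of constants of `K`, seen in the image of `C_K` in `L`. -/
def pMonomialIn (L : Type*) [Field L] [CharP L p] [Algebra K L] {A : Set K}
    (hA : A ⊆ (constantField K : Set K)) (e : {e : A →₀ ℕ // ∀ a, e a < p}) :
    constantsIn p K L :=
  ⟨algebraMap K L (pMonomial p A e), _, pMonomial_mem_constantField hA e, rfl⟩

theorem DiffPIndependent.linearIndependent_pMonomialIn {A : Set K} (hA : DiffPIndependent p A) :
    LinearIndependent (pthPowers p K) (pMonomialIn L hA.1) :=
  .of_comp (constantsIn p K L).val.toLinearMap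
    (hA.2.map' (IsScalarTower.toAlgHom (pthPowers p K) K L).toLinearMap
      (LinearMap.ker_eq_bot.2 (algebraMap K L).injective))

theorem DiffPSpanning.span_pMonomialIn {A : Set K} (hA : DiffPSpanning p A) :
    Submodule.span (pthPowers p K) (Set.range (pMonomialIn L hA.1)) = ⊤ := by
  rw [eq_top_iff]
  rintro ⟨_, c, hc, rfl⟩ -
  have hc' : c ∈ Submodule.span (pthPowers p K) (Set.range (pMonomial p A)) := by
    rw [← SetLike.mem_coe, hA.2]
    exact hc
  have h := Submodule.mem_map_of_mem
    (f := (IsScalarTower.toAlgHom (pthPowers p K) K L).toLinearMap) hc'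
  have heq : (Submodule.span (pthPowers p K) (Set.range (pMonomial p A))).map
      (IsScalarTower.toAlgHom (pthPowers p K) K L).toLinearMap =
      (Submodule.span (pthPowers p K) (Set.range (pMonomialIn L hA.1))).map
        (constantsIn p K L).val.toLinearMap := by
    rw [Submodule.map_span, Submodule.map_span, ← Set.range_comp, ← Set.range_comp]
    rfl
  rw [heq] at h
  obtain ⟨y, hy, hyc⟩ := h
  have hy' : y = ⟨_, c, hc, rfl⟩ := Subtype.ext hyc
  rw [← hy']
  exact hy

theorem linearIndependent_pMonomial_image {F : Type*} [Field F] [Algebra F L] {A : Set K} :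
    LinearIndependent F (pMonomial p (algebraMap K L '' A)) ↔
      LinearIndependent F (algebraMap K L ∘ pMonomial p A) := by
  let f : A ≃ algebraMap K L '' A := Equiv.Set.image _ A (algebraMap K L).injective
  let g : {e : A →₀ ℕ // ∀ a, e a < p} ≃ {e : (algebraMap K L '' A) →₀ ℕ // ∀ a, e a < p} :=
    (Finsupp.equivCongrLeft f).subtypeEquiv fun e =>
      ⟨fun h a => h _, fun h a => by simpa using h (f a)⟩
  refine (linearIndependent_equiv' g ?_).symm
  ext e
  have hfa (a : A) : ((f a : algebraMap K L '' A) : L) = algebraMap K L a := rfl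
  have : pMonomial p _ (g e) = e.1.prod fun a n => (f a : L) ^ n := by
    change (Finsupp.equivMapDomain f e.1).prod _ = _
    rw [Finsupp.equivMapDomain_eq_mapDomain, Finsupp.prod_mapDomain_index_inj f.injective]
  simp only [Function.comp_apply, this, hfa]
  simp [pMonomial, Finsupp.prod, map_prod]

end Extension

theorem DiffPIndependent.image_algebraMap {p : ℕ} [Fact p.Prime] {K L : Type*} [Field K] [CharP K p]
    [Field L] [CharP L p] [Differential K] [Differential L] [Algebra K L] [DifferentialAlgebra K L]
    (h : (constantsIn p K L).LinearDisjoint (pthPowersIn p K L)) {A : Set K}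
    (hA : DiffPIndependent p A) : DiffPIndependent p (algebraMap K L '' A) := by
  refine ⟨?_, linearIndependent_pMonomial_image.2 ?_⟩
  · rintro _ ⟨a, ha, rfl⟩
    exact algebraMap_mem_constantField (hA.1 ha)
  · rw [← linearIndependent_pthPowersIn_iff (K := K)]
    have h1 := h.linearIndependent_left (hA.linearIndependent_pMonomialIn (L := L))
    have heq : (constantsIn p K L).val ∘ pMonomialIn L hA.1 = algebraMap K L ∘ pMonomial p A := rfl
    rwa [heq] at h1

theorem mainTheorem9 (p : ℕ) [Fact p.Prime] (K L : Type*) [Field K] [CharP K p] [Field L]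
    [CharP L p] [Differential K] [Differential L] [Algebra K L] [DifferentialAlgebra K L] :
    List.TFAE [
      IsSeparableExt p K L,
      (constantsIn p K L).LinearDisjoint (pthPowersIn p K L),
      ∀ A : Set K, DiffPIndependent p A → DiffPIndependent p (algebraMap K L '' A),
      ∃ A : Set K, IsDiffPBasis p A ∧ DiffPIndependent p (algebraMap K L '' A)] := by
  tfae_have 1 → 2 := fun h => h.of_le_left constantsIn_le_baseIn
  tfae_have 2 → 1 := fun h => by
    let b := Module.Free.chooseBasis (pthPowers p K) (pthPowersIn p K L)
    refine .of_basis_right b (linearIndependent_baseIn (.of_constantField (fun i => ?_)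
      (.of_constantsIn (h.linearIndependent_right b.linearIndependent))))
    -- Basis elements are `p`-th powers in `L`, hence constants.
    exact pthPowers_le_constantField p L (b i).2
  tfae_have 2 → 3 := fun h A hA => hA.image_algebraMap h
  tfae_have 3 → 4 := fun h => by
    obtain ⟨A, hA⟩ := exists_isDiffPBasis p K
    exact ⟨A, hA, h A hA.1⟩
  tfae_have 4 → 2 := fun ⟨A, hA, hAL⟩ => by
    let b := Module.Basis.mk hA.1.linearIndependent_pMonomialIn (hA.2.span_pMonomialIn (L := L)).ge
    have hb : (constantsIn p K L).val ∘ b = algebraMap K L ∘ pMonomial p A := by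
      rw [Module.Basis.coe_mk]
      rfl
    refine .of_basis_left b ?_
    rw [hb, linearIndependent_pthPowersIn_iff]
    exact linearIndependent_pMonomial_image.1 hAL.2
  tfae_finish
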